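/- Let $n\in\mathbb N$, $T>0$, $\Omega=(0,T)\times\mathbb R^n$, and let $|\cdot|$, $\langle\cdot,\cdot\rangle$ be the Euclidean norm and scalar product. Let $H\in C^1([0,T]\times\mathbb R^n)$ and let $\sigma\in C^1(\mathbb R^n)$ be convex and Lipschitz, with Fenchel conjugate $\sigma^*(q)=\sup_{x\in\mathbb R^n}(\langle x,q\rangle-\sigma(x))\in(-\infty,+\infty]$. Put $$\varphi(t,x,q)=\langle x,q\rangle-\sigma^*(q)-\int_0^tH(\tau,q)\,d\tau,\qquad u(t,x)=\max_{q\in\mathbb R^n}\varphi(t,x,q)\qquad(t\in[0,T],\ x\in\mathbb R^n).$$ Assume: (A1) for every $(t_0,x_0)\in[0,T)\times\mathbb R^n$ there are $r,N>0$ such that $\varphi(t,x,p)<\max_{|q|\le N}\varphi(t,x,q)$ whenever $(t,x)\in[0,T)\times\mathbb R^n$, $|t-t_0|+|x-x_0|<r$ and $|p|>N$; (A2) one of the following holds: (a) $H(t,\cdot)$ is convex for all $t\in(0,T)$, or $H(t,\cdot)$ is concave for all $t\in(0,T)$; (b) $H(t,p)=g(t)h(p)+k(t)$ for all $t\in(0,T)$,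 $p\in\mathbb R^n$, with functions $g,h,k$ such that $g\ge0$ on $(0,T)$ or $g\le0$ on $(0,T)$. A point of $\Omega$ is called singular if $u$ is not differentiable (in $(t,x)$ jointly) at it. Suppose that $(t_0,x_0)\in\Omega$ is singular. Then: 1. For every $\varepsilon>0$ and every $t\in(t_0,T)$ there is a singular point $(t,x)\in\Omega$ with $|x-x_0|\le m\varepsilon$ for some $m\in\mathbb N$. 2. Singularities propagate forward in time up to $T$: for every $\varepsilon>0$ there is $m\in\mathbb N$ such that for every $t\in(t_0,T]$ there is $x\in\mathbb R^n$ with $|x-x_0|\le m\varepsilon$ such that $u$, as a function on $(0,T]\times\mathbb R^n$, is not differentiable at $(t,x)$. -/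

import Mathlib

open Set

noncomputable section

namespace HopfFormula

/-- `ℝⁿ` with its Euclidean norm and scalar product. -/
abbrev Rn (n : ℕ) : Type := EuclideanSpace ℝ (Fin n)

/-- The Fenchel conjugate `σ*(q) = sup_x (⟨x, q⟩ - σ(x))`, with values in `(-∞, +∞]`. -/
def fenchelConj {n : ℕ} (σ : Rn n → ℝ) (q : Rn n) : EReal :=
  ⨆ x : Rn n, ((inner ℝ x q - σ x : ℝ) : EReal)

/-- `φ(t, x, q) = ⟨x, q⟩ - σ*(q) - ∫₀ᵗ H(τ, q) dτ`, with values in `[-∞, +∞)`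
(the value is `-∞` exactly when `q` is outside the effective domain of `σ*`). -/
def phi {n : ℕ} (H : ℝ → Rn n → ℝ) (σ : Rn n → ℝ) (t : ℝ) (x q : Rn n) : EReal :=
  ((inner ℝ x q - ∫ τ in (0 : ℝ)..t, H τ q : ℝ) : EReal) - fenchelConj σ q

/-- The Hopf-type formula `u(t, x) = max_q φ(t, x, q)`, as a real-valued function on pairs
`(t, x)`. Under assumption (A1) the supremum is a finite maximum, see `isGreatest_hopf`. -/
def hopf {n : ℕ} (H : ℝ → Rn n → ℝ) (σ : Rn n → ℝ) (z : ℝ × Rn n) : ℝ :=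
  (⨆ q : Rn n, phi H σ z.1 z.2 q).toReal

/-- Assumption (A1): locally uniformly in `(t, x) ∈ [0, T) × ℝⁿ`, the values `φ(t, x, p)` with
`|p| > N` are strictly below `max_{|q| ≤ N} φ(t, x, q)`, the maximum being attained at `q₀`. -/
def AssumptionA1 {n : ℕ} (T : ℝ) (H : ℝ → Rn n → ℝ) (σ : Rn n → ℝ) : Prop :=
  ∀ t₀ ∈ Ico 0 T, ∀ x₀ : Rn n, ∃ r > (0 : ℝ), ∃ N > (0 : ℝ),
    ∀ t ∈ Ico 0 T, ∀ x : Rn n, |t - t₀| + ‖x - x₀‖ < r →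
      ∃ q₀ : Rn n, ‖q₀‖ ≤ N ∧ (∀ q : Rn n, ‖q‖ ≤ N → phi H σ t x q ≤ phi H σ t x q₀) ∧
        ∀ p : Rn n, N < ‖p‖ → phi H σ t x p < phi H σ t x q₀

/-- Assumption (A2): either `H(t, ·)` is convex for all `t ∈ (0, T)`, or it is concave for all
`t ∈ (0, T)`, or `H(t, p) = g(t) h(p) + k(t)` where `g` does not change sign on `(0, T)`. -/
def AssumptionA2 {n : ℕ} (T : ℝ) (H : ℝ → Rn n → ℝ) : Prop :=
  ((∀ t ∈ Ioo 0 T, ConvexOn ℝ univ (H t)) ∨ (∀ t ∈ Ioo 0 T, ConcaveOn ℝ univ (H t))) ∨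
  ∃ (g : ℝ → ℝ) (h : Rn n → ℝ) (k : ℝ → ℝ),
    (∀ t ∈ Ioo 0 T, ∀ p : Rn n, H t p = g t * h p + k t) ∧
    ((∀ t ∈ Ioo 0 T, 0 ≤ g t) ∨ (∀ t ∈ Ioo 0 T, g t ≤ 0))

/-- A point of `Ω = (0, T) × ℝⁿ` is singular for `u` if `u` is not differentiable at it
(jointly in `(t, x)`). -/
def IsSingularPoint {n : ℕ} (T : ℝ) (u : ℝ × Rn n → ℝ) (z : ℝ × Rn n) : Prop :=
  z ∈ Ioo 0 T ×ˢ (univ : Set (Rn n)) ∧ ¬ DifferentiableAt ℝ u z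

theorem fenchelConj_ne_bot {n : ℕ} (σ : Rn n → ℝ) (q : Rn n) : fenchelConj σ q ≠ ⊥ := by
  intro h
  have h1 : ((inner ℝ (0 : Rn n) q - σ 0 : ℝ) : EReal) ≤ fenchelConj σ q :=
    le_iSup (fun x : Rn n => ((inner ℝ x q - σ x : ℝ) : EReal)) 0
  rw [h] at h1
  exact EReal.coe_ne_bot _ (le_bot_iff.mp h1)

theorem phi_ne_top {n : ℕ} (H : ℝ → Rn n → ℝ) (σ : Rn n → ℝ) (t : ℝ) (x q : Rn n) :
    phi H σ t x q ≠ ⊤ := by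
  have h := fenchelConj_ne_bot σ q
  unfold phi
  generalize fenchelConj σ q = a at h ⊢
  induction a using EReal.rec with
  | bot => exact absurd rfl h
  | top => simp [EReal.sub_top]
  | coe a => rw [← EReal.coe_sub]; exact EReal.coe_ne_top _

/-- Under (A1), `u(t, x)` really is the maximum of `φ(t, x, ·)`. -/
theorem isGreatest_hopf {n : ℕ} {T : ℝ} {H : ℝ → Rn n → ℝ} {σ : Rn n → ℝ}
    (hA1 : AssumptionA1 T H σ) {t : ℝ} (ht : t ∈ Ico 0 T) (x : Rn n) :
    IsGreatest (range (phi H σ t x)) ((hopf H σ (t, x) : ℝ) : EReal) := by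
  obtain ⟨r, hr, N, hN, h⟩ := hA1 t ht x
  obtain ⟨q₀, hq₀, h1, h2⟩ := h t ht x (by simpa using hr)
  have hle : ∀ q, phi H σ t x q ≤ phi H σ t x q₀ := fun q =>
    (le_or_gt ‖q‖ N).elim (h1 q) (fun hq => (h2 q hq).le)
  have hsup : (⨆ q : Rn n, phi H σ t x q) = phi H σ t x q₀ :=
    le_antisymm (iSup_le hle) (le_iSup (phi H σ t x) q₀)
  have hbot : phi H σ t x q₀ ≠ ⊥ := by
    rcases Nat.eq_zero_or_pos n with rfl | hn
    · have hc : fenchelConj σ q₀ = ((inner ℝ (0 : Rn 0) q₀ - σ 0 : ℝ) : EReal) := by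
        unfold fenchelConj
        refine le_antisymm (iSup_le fun y => ?_)
          (le_iSup (fun x : Rn 0 => ((inner ℝ x q₀ - σ x : ℝ) : EReal)) 0)
        rw [Subsingleton.elim y 0]
      unfold phi
      rw [hc, ← EReal.coe_sub]
      exact EReal.coe_ne_bot _
    · have : Nonempty (Fin n) := ⟨⟨0, hn⟩⟩
      obtain ⟨p, hp⟩ := NormedSpace.exists_lt_norm ℝ (Rn n) N
      exact ne_bot_of_gt (h2 p hp)
  have hval : ((hopf H σ (t, x) : ℝ) : EReal) = phi H σ t x q₀ := by
    unfold hopf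
    simp only [hsup]
    exact EReal.coe_toReal (phi_ne_top H σ t x q₀) hbot
  rw [hval]
  exact ⟨⟨q₀, rfl⟩, by rintro _ ⟨q, rfl⟩; exact hle q⟩

end HopfFormula

end

/-! The argument is by contraposition. Let `D` be the effective domain of `σ*`; it is bounded
because `σ` is Lipschitz. Each slice `u(t, ·)` is the conjugate over `D` of `Ψ_t = σ* + ∫₀ᵗ H`, and
`u(0, ·) = σ` is differentiable everywhere. If a conjugate is differentiable at a point, its
maximizer there is unique and equals the gradient (`IsConjugate.unique`). Conversely, uniqueness of
the maximizer at an interior time gives joint differentiability of `u`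
(`differentiableAt_hopf_of_unique`).

It remains to carry uniqueness back from a later time `t₁` to `(t₀, x₀)`. One looks for a point `y`
and an `r` maximal at `y` for a regular conjugate such that every maximizer at `(t₀, x₀)` is also
maximal at `y`; it then equals `r`. Such a `y` minimizes an infimal convolution over a ball around
`x₀`. For concave `H`, `Ψ_{t₁}` is `Ψ_{t₀}` plus a concave function; for convex `H`, so is `Ψ_0`
(`isMaximizer_unique_of_add_concave`). For separable `H`, `Ψ_{t₀}` is, up to a constant, a convex
combination of `Ψ_0` and `Ψ_{t₁}` (`isMaximizer_unique_of_convex_combination`). The radius depends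
only on `T` and a Lipschitz constant of `H` in `q`, which makes the final bound uniform in time. -/

namespace HopfFormula

/-! ### Conjugates over a bounded set and uniqueness of maximizers. -/

section Conjugate

variable {E : Type*} [NormedAddCommGroup E] [InnerProductSpace ℝ E]

/-- `q` maximizes `⟨y, ·⟩ - Ψ` over `D`. -/
def IsMaximizer (D : Set E) (Ψ : E → ℝ) (y q : E) : Prop :=
  q ∈ D ∧ ∀ p ∈ D, inner ℝ y p - Ψ p ≤ inner ℝ y q - Ψ q

/-- `U` is the conjugate of `Ψ` restricted to `D`, the supremum being attained everywhere. -/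
def IsConjugate (D : Set E) (Ψ U : E → ℝ) : Prop :=
  ∀ y, ∃ q, IsMaximizer D Ψ y q ∧ U y = inner ℝ y q - Ψ q

variable {D : Set E} {Ψ U : E → ℝ}

theorem IsMaximizer.congr_const {Ψ' : E → ℝ} {y q : E} (c : ℝ) (h : IsMaximizer D Ψ y q)
    (hc : ∀ p ∈ D, Ψ' p = Ψ p + c) : IsMaximizer D Ψ' y q :=
  ⟨h.1, fun p hp => by rw [hc p hp, hc q h.1]; linarith [h.2 p hp]⟩

theorem IsConjugate.le (h : IsConjugate D Ψ U) (y : E) {p : E} (hp : p ∈ D) :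
    inner ℝ y p - Ψ p ≤ U y := by
  obtain ⟨q, hq, e⟩ := h y
  rw [e]; exact hq.2 p hp

theorem IsConjugate.eq (h : IsConjugate D Ψ U) {y q : E} (hq : IsMaximizer D Ψ y q) :
    U y = inner ℝ y q - Ψ q := by
  obtain ⟨q', hq', e⟩ := h y
  exact le_antisymm (e ▸ hq.2 q' hq'.1) (h.le y hq.1)

/-- One-sided minimality is all that is available later: minimizers over a closed ball may lie on
its boundary, where only segments into the ball can be tested. -/
theorem nonneg_of_hasDerivAt_of_min {f : ℝ → ℝ} {d : ℝ} (hf : HasDerivAt f d 0)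
    (h : ∀ s ∈ Icc (0 : ℝ) 1, f 0 ≤ f s) : 0 ≤ d := by
  have hm : IsLocalMinOn f (Icc 0 1) 0 :=
    Filter.eventually_of_mem self_mem_nhdsWithin h
  have := hm.hasFDerivWithinAt_nonneg hf.hasFDerivAt.hasFDerivWithinAt (y := 1)
    (mem_posTangentConeAt_of_segment_subset (by simp [segment_eq_Icc]))
  simpa using this

theorem HasFDerivAt.hasDerivAt_line {f : E → ℝ} {f' : E →L[ℝ] ℝ} {y : E}
    (hf : HasFDerivAt f f' y) (v : E) : HasDerivAt (fun s : ℝ => f (y + s • v)) (f' v) 0 := by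
  have h1 : HasDerivAt (fun s : ℝ => y + s • v) v 0 := by
    simpa using ((hasDerivAt_id (0 : ℝ)).smul_const v).const_add y
  have hf' : HasFDerivAt f f' (y + (0 : ℝ) • v) := by simpa using hf
  exact hf'.comp_hasDerivAt 0 h1

/-- The affine function with slope `q` lies below `U` and touches it at `y`, so the derivative must
have the same slope. -/
theorem IsConjugate.hasFDerivAt (h : IsConjugate D Ψ U) {y q : E}
    (hU : DifferentiableAt ℝ U y) (hq : IsMaximizer D Ψ y q) :
    HasFDerivAt U (innerSL ℝ q) y := by
  have key : ∀ v, inner ℝ q v ≤ fderiv ℝ U y v := by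
    intro v
    have h1 := HasFDerivAt.hasDerivAt_line hU.hasFDerivAt v
    have h2 : HasDerivAt (fun s : ℝ => U (y + s • v) - s * inner ℝ q v)
        (fderiv ℝ U y v - inner ℝ q v) 0 := by
      have := h1.sub ((hasDerivAt_id (0 : ℝ)).mul_const (inner ℝ q v))
      rw [one_mul] at this
      exact this
    have := nonneg_of_hasDerivAt_of_min h2 (fun s _ => by
      have := h.le (y + s • v) hq.1
      rw [inner_add_left, real_inner_smul_left, real_inner_comm q v] at this
      simp only [zero_smul, add_zero, zero_mul, sub_zero]
      rw [h.eq hq]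
      linarith)
    linarith
  have e : fderiv ℝ U y = innerSL ℝ q := by
    ext v
    refine le_antisymm ?_ (key v)
    have := key (-v)
    rw [inner_neg_right, map_neg] at this
    simpa using this
  exact e ▸ hU.hasFDerivAt

theorem IsConjugate.unique (h : IsConjugate D Ψ U) {y p q : E}
    (hU : DifferentiableAt ℝ U y) (hp : IsMaximizer D Ψ y p) (hq : IsMaximizer D Ψ y q) :
    p = q := by
  have := (h.hasFDerivAt hU hp).unique (h.hasFDerivAt hU hq)
  exact ext_inner_right ℝ fun v => by simpa using congrArg (fun f => f v) this

theorem IsConjugate.lipschitz (h : IsConjugate D Ψ U) {K : ℝ} (hK : ∀ q ∈ D, ‖q‖ ≤ K)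
    (x y : E) : U x - U y ≤ K * ‖x - y‖ := by
  obtain ⟨q, hq, e⟩ := h x
  have h1 := h.le y hq.1
  have h2 : inner ℝ (x - y) q ≤ ‖x - y‖ * ‖q‖ := real_inner_le_norm _ _
  rw [inner_sub_left] at h2
  nlinarith [mul_le_mul_of_nonneg_left (hK q hq.1) (norm_nonneg (x - y))]

theorem IsConjugate.continuous (h : IsConjugate D Ψ U) {K : ℝ} (hK : ∀ q ∈ D, ‖q‖ ≤ K) :
    Continuous U := by
  have : LipschitzWith K.toNNReal U := LipschitzWith.of_le_add_mul' K fun x y => by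
    have := h.lipschitz hK x y
    rw [dist_eq_norm]; linarith
  exact this.continuous

theorem IsConjugate.convex (h : IsConjugate D Ψ U) {a b : ℝ} (ha : 0 ≤ a) (hb : 0 ≤ b)
    (hab : a + b = 1) (x y : E) : U (a • x + b • y) ≤ a * U x + b * U y := by
  obtain ⟨q, hq, e⟩ := h (a • x + b • y)
  have h1 := mul_le_mul_of_nonneg_left (h.le x hq.1) ha
  have h2 := mul_le_mul_of_nonneg_left (h.le y hq.1) hb
  rw [e, inner_add_left, real_inner_smul_left, real_inner_smul_left]
  have : Ψ q = a * Ψ q + b * Ψ q := by rw [← add_mul, hab, one_mul]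
  linarith

theorem exists_isConjugate (hD : IsCompact D) (hne : D.Nonempty) (hΨ : Continuous Ψ) :
    ∃ U, IsConjugate D Ψ U := by
  have : ∀ y, ∃ q, IsMaximizer D Ψ y q := fun y =>
    hD.exists_isMaxOn (f := fun q => inner ℝ y q - Ψ q) hne (by fun_prop)
  choose q hq using this
  exact ⟨fun y => inner ℝ y (q y) - Ψ (q y), fun y => ⟨q y, hq y, rfl⟩⟩

/-- A continuous concave function has a supergradient at every point. -/
theorem exists_supergradient [CompleteSpace E] {G : E → ℝ} (hG : ConcaveOn ℝ univ G)
    (hc : Continuous G) (q : E) : ∃ ζ : E, ∀ p, G p ≤ G q + inner ℝ ζ (p - q) := by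
  obtain ⟨f, hf⟩ := geometric_hahn_banach_open_point (E := E × ℝ)
    hG.convex_strict_hypograph
    (by simpa using isOpen_lt continuous_snd (hc.comp continuous_fst)) (x := (q, G q)) (by simp)
  have hfs : ∀ p r, f (p, r) = f (p, 0) + r * f (0, 1) := fun p r => by
    have : (p, r) = (p, (0 : ℝ)) + r • ((0 : E), (1 : ℝ)) := by simp
    rw [this, map_add, map_smul, smul_eq_mul]
  -- The separating hyperplane is not vertical, since `(q, G q - 1)` lies strictly below the graph
  -- point.
  have hb : 0 < f (0, 1) := by
    have := hf (q, G q - 1) (by simp)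
    rw [hfs q (G q - 1), hfs q (G q)] at this
    linarith
  set β := f (0, 1)
  set ζ := (InnerProductSpace.toDual ℝ E).symm (f.comp (ContinuousLinearMap.inl ℝ E ℝ))
  have hζ : ∀ v, inner ℝ ζ v = f (v, 0) := fun v => by
    simp [ζ, InnerProductSpace.toDual_symm_apply]
  refine ⟨-(β⁻¹ • ζ), fun p => ?_⟩
  have h1 : f (p, 0) + G p * β ≤ f (q, 0) + G q * β := by
    refine le_of_forall_pos_lt_add fun e he => ?_
    have := hf (p, G p - e / β) (by simp; positivity)
    rw [hfs p, hfs q (G q)] at this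
    have e1 : (G p - e / β) * β = G p * β - e := by field_simp
    linarith
  rw [inner_neg_left, real_inner_smul_left, inner_sub_right, hζ, hζ]
  have : β * (G p) ≤ β * (G q + -(β⁻¹ * (f (p, 0) - f (q, 0)))) := by
    have : β * (G q + -(β⁻¹ * (f (p, 0) - f (q, 0)))) = β * G q - (f (p, 0) - f (q, 0)) := by
      field_simp; ring
    rw [this]; linarith
  exact le_of_mul_le_mul_left this hb

/-- Test the supergradient inequality one unit away from `q`, in the direction `-ζ`. The unit step
is why the Lipschitz bound is needed on radius `K + 1`. -/
theorem norm_supergradient_le {G : E → ℝ} {L K : ℝ} (hL0 : 0 ≤ L)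
    (hL : ∀ p q, ‖p‖ ≤ K + 1 → ‖q‖ ≤ K + 1 → |G p - G q| ≤ L * ‖p - q‖) {q ζ : E}
    (hq : ‖q‖ ≤ K) (hζ : ∀ p, G p ≤ G q + inner ℝ ζ (p - q)) : ‖ζ‖ ≤ L := by
  rcases eq_or_ne ζ 0 with rfl | h0
  · simpa
  have hn : 0 < ‖ζ‖ := norm_pos_iff.2 h0
  have h1 : ‖-(‖ζ‖⁻¹ • ζ)‖ = 1 := by rw [norm_neg, norm_smul, norm_inv, norm_norm, inv_mul_cancel₀ hn.ne']
  have h2 := hζ (q + -(‖ζ‖⁻¹ • ζ))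
  have h3 := hL (q + -(‖ζ‖⁻¹ • ζ)) q ((norm_add_le _ _).trans (by rw [h1]; linarith)) (by linarith)
  rw [add_sub_cancel_left, inner_neg_right, real_inner_smul_right, real_inner_self_eq_norm_sq] at h2
  rw [add_sub_cancel_left, h1] at h3
  have h4 : ‖ζ‖⁻¹ * ‖ζ‖ ^ 2 = ‖ζ‖ := by field_simp
  linarith [(abs_le.1 h3).1]

/-- With `V` the conjugate of `-G` over the ball of radius `K`, minimize `U y + V (x₀ - y)`.
Optimality says that the gradient `r` of `U` at the minimizer also attains `V (x₀ - y)`. A possible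
boundary minimizer is harmless: the only competitor tested is `x₀ + ζ` with `ζ` a supergradient of
`G` at `r`, and `‖ζ‖ ≤ L ≤ M` keeps it in the ball. -/
theorem isMaximizer_unique_of_add_concave [FiniteDimensional ℝ E] {Ψ₀ Ψ₁ G U : E → ℝ}
    {K L M : ℝ} {x₀ : E} (hK : ∀ q ∈ D, ‖q‖ ≤ K) (hΨ : ∀ q ∈ D, Ψ₁ q = Ψ₀ q + G q)
    (hU : IsConjugate D Ψ₁ U) (hG : ConcaveOn ℝ univ G) (hc : Continuous G) (hL0 : 0 ≤ L)
    (hL : ∀ p q, ‖p‖ ≤ K + 1 → ‖q‖ ≤ K + 1 → |G p - G q| ≤ L * ‖p - q‖) (hLM : L ≤ M)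
    (hd : ∀ y, ‖y - x₀‖ ≤ M → DifferentiableAt ℝ U y) {p q : E}
    (hp : IsMaximizer D Ψ₀ x₀ p) (hq : IsMaximizer D Ψ₀ x₀ q) : p = q := by
  have hcomp : IsCompact {q : E | ‖q‖ ≤ K} := by
    simpa [Metric.closedBall, dist_eq_norm] using isCompact_closedBall (0 : E) K
  obtain ⟨V, hV⟩ := exists_isConjugate hcomp ⟨p, hK p hp.1⟩ hc.neg
  have hVc : Continuous V := hV.continuous fun _ h => h
  have hM0 : 0 ≤ M := hL0.trans hLM
  obtain ⟨y, hyM, hy⟩ := (isCompact_closedBall x₀ M).exists_isMinOn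
    (f := fun y => U y + V (x₀ - y)) ⟨x₀, by simpa⟩
    ((hU.continuous hK).add (hVc.comp (continuous_const.sub continuous_id))).continuousOn
  have hyM' : ‖y - x₀‖ ≤ M := by simpa [dist_eq_norm] using hyM
  obtain ⟨r, hr, -⟩ := hU y
  have hUr := hU.hasFDerivAt (hd y hyM') hr
  obtain ⟨ζ, hζ⟩ := exists_supergradient hG hc r
  have hζL := norm_supergradient_le hL0 hL (hK r hr.1) hζ
  -- the point at which the supergradient inequality is tested
  have hz : x₀ + ζ ∈ Metric.closedBall x₀ M := by simpa using hζL.trans hLM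
  have hVz : V (x₀ - (x₀ + ζ)) = inner ℝ (x₀ - (x₀ + ζ)) r - -G r := by
    refine hV.eq ⟨hK r hr.1, fun p _ => ?_⟩
    have := hζ p
    simp only [sub_add_cancel_left, inner_neg_left, inner_sub_right, Pi.neg_apply] at this ⊢
    linarith
  have hmin : V (x₀ - y) ≤ inner ℝ r (x₀ + ζ - y) + V (x₀ - (x₀ + ζ)) := by
    have h1 := HasFDerivAt.hasDerivAt_line hUr (x₀ + ζ - y)
    have h2 := h1.add ((hasDerivAt_id (0 : ℝ)).mul_const (V (x₀ - (x₀ + ζ)) - V (x₀ - y)))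
    have := nonneg_of_hasDerivAt_of_min h2 (fun s hs => by
      have hm : y + s • (x₀ + ζ - y) ∈ Metric.closedBall x₀ M :=
        (convex_closedBall x₀ M).add_smul_sub_mem hyM hz hs
      have h3 : U y + V (x₀ - y) ≤ _ := hy hm
      have h4 := hV.convex (sub_nonneg.2 hs.2) hs.1 (by ring) (x₀ - y) (x₀ - (x₀ + ζ))
      have e : x₀ - (y + s • (x₀ + ζ - y)) = (1 - s) • (x₀ - y) + s • (x₀ - (x₀ + ζ)) := by
        module
      simp only [e] at h3
      simp only [Pi.add_apply, zero_smul, add_zero, id, zero_mul]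
      linarith)
    simp only [innerSL_apply_apply, one_mul] at this
    linarith
  -- The terms in `ζ` cancel in `hmin`, leaving that `r` attains the supremum defining `V (x₀ - y)`.
  have hVy : ∀ p ∈ D, inner ℝ (x₀ - y) p + G p ≤ inner ℝ (x₀ - y) r + G r := by
    intro p hp
    have h1 := hV.le (x₀ - y) (hK p hp)
    rw [hVz] at hmin
    simp only [Pi.neg_apply, sub_add_cancel_left, inner_neg_left, inner_sub_right, inner_add_right,
      inner_sub_left] at hmin h1 ⊢
    linarith [real_inner_comm r x₀, real_inner_comm r y, real_inner_comm r ζ]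
  -- Subtracting `hVy` from the maximality of `p` at `x₀` for `Ψ₀` makes `p` at least as good as `r`
  -- at `y` for `Ψ₁`.
  have huniq : ∀ p, IsMaximizer D Ψ₀ x₀ p → p = r := by
    intro p hp
    refine hU.unique (hd y hyM') ⟨hp.1, fun p' hp' => (hr.2 p' hp').trans ?_⟩ hr
    have h1 := hVy p hp.1
    have h2 := hp.2 r hr.1
    rw [hΨ r hr.1, hΨ p hp.1]
    rw [inner_sub_left, inner_sub_left] at h1
    linarith
  rw [huniq p hp, huniq q hq]

/-- Split `x₀ = (1 - θ) y₀ + θ y` so as to minimize `(1 - θ) U₀ y₀ + θ U₁ y`. At the optimum both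
gradients are the same `r`, so `r` maximizes both parts of the combined objective, and any other
maximizer at `x₀` must be maximal for `Ψ₁` at `y`. -/
theorem isMaximizer_unique_of_convex_combination [FiniteDimensional ℝ E] {Ψ₀ Ψ₁ U₀ U₁ : E → ℝ}
    {K L M θ : ℝ} {x₀ : E} (hK : ∀ q ∈ D, ‖q‖ ≤ K)
    (hU₀ : IsConjugate D Ψ₀ U₀) (hU₁ : IsConjugate D Ψ₁ U₁) (hL0 : 0 ≤ L)
    (hL : ∀ p ∈ D, ∀ q ∈ D, |(Ψ₁ p - Ψ₀ p) - (Ψ₁ q - Ψ₀ q)| ≤ L * ‖p - q‖) (hLM : L < M)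
    (hθ : θ ∈ Ioo (0 : ℝ) 1) (hd₀ : ∀ y, DifferentiableAt ℝ U₀ y)
    (hd₁ : ∀ y, ‖y - x₀‖ ≤ M → DifferentiableAt ℝ U₁ y) {p q : E}
    (hp : IsMaximizer D (fun r => (1 - θ) * Ψ₀ r + θ * Ψ₁ r) x₀ p)
    (hq : IsMaximizer D (fun r => (1 - θ) * Ψ₀ r + θ * Ψ₁ r) x₀ q) : p = q := by
  obtain ⟨hθ0, hθ1⟩ := hθ
  have hθ1' : 0 < 1 - θ := sub_pos.2 hθ1
  have hM0 : 0 < M := hL0.trans_lt hLM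
  -- This ratio makes `(1 - θ) (x₀ - a (y - x₀)) + θ y = x₀`.
  set a : ℝ := θ / (1 - θ) with ha
  have ha0 : 0 < a := div_pos hθ0 hθ1'
  have haθ : (1 - θ) * a = θ := by rw [ha]; field_simp
  obtain ⟨y, hyM, hy⟩ := (isCompact_closedBall x₀ M).exists_isMinOn
    (f := fun y => (1 - θ) * U₀ (x₀ - a • (y - x₀)) + θ * U₁ y) ⟨x₀, by simpa using hM0.le⟩
    (by
      have := hU₀.continuous hK
      have := hU₁.continuous hK
      fun_prop)
  have hyM' : ‖y - x₀‖ ≤ M := by simpa [dist_eq_norm] using hyM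
  set y₀ := x₀ - a • (y - x₀) with hy₀
  obtain ⟨r, hr, -⟩ := hU₁ y
  obtain ⟨r₀, hr₀, -⟩ := hU₀ y₀
  -- If the gradients differ by `w ≠ 0`, minimality forces `⟨w, x₀ - y⟩ ≥ M ‖w‖`, while adding the
  -- two maximality inequalities gives `(1 + a) ⟨w, x₀ - y⟩ ≤ L ‖w‖`. This contradicts `L < M`.
  have hrr : r₀ = r := by
    by_contra hne
    have hw : 0 < ‖r - r₀‖ := norm_pos_iff.2 (sub_ne_zero.2 (Ne.symm hne))
    set w := r - r₀
    -- test the minimality of `y` in the direction of `z`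
    set z := x₀ - (M * ‖w‖⁻¹) • w with hz
    have hzM : z ∈ Metric.closedBall x₀ M := by
      rw [Metric.mem_closedBall, dist_eq_norm, hz, sub_sub_cancel_left, norm_neg, norm_smul,
        Real.norm_of_nonneg (by positivity), inv_mul_cancel_right₀ hw.ne']
    have h1 := HasFDerivAt.hasDerivAt_line (hU₁.hasFDerivAt (hd₁ y hyM') hr) (z - y)
    have h0 := HasFDerivAt.hasDerivAt_line (hU₀.hasFDerivAt (hd₀ y₀) hr₀) (-(a • (z - y)))
    have h2 := (h0.const_mul (1 - θ)).add (h1.const_mul θ)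
    have h3 := nonneg_of_hasDerivAt_of_min h2 (fun s hs => by
      have hm : y + s • (z - y) ∈ Metric.closedBall x₀ M :=
        (convex_closedBall x₀ M).add_smul_sub_mem hyM hzM hs
      have h3 : (1 - θ) * U₀ y₀ + θ * U₁ y ≤ _ := hy hm
      have e : x₀ - a • (y + s • (z - y) - x₀) = y₀ + s • -(a • (z - y)) := by
        rw [hy₀]; module
      simp only [e] at h3
      simpa using h3)
    have h4 : 0 ≤ θ * inner ℝ w (z - y) := by
      simp only [innerSL_apply_apply, inner_neg_right, real_inner_smul_right] at h3
      have : θ * inner ℝ w (z - y) =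
          (1 - θ) * -(a * inner ℝ r₀ (z - y)) + θ * inner ℝ r (z - y) := by
        rw [show w = r - r₀ from rfl, inner_sub_left]
        linear_combination (inner ℝ r₀ (z - y)) * haθ
      rw [this]; exact h3
    have h5 : 0 ≤ inner ℝ w (z - y) := nonneg_of_mul_nonneg_right h4 hθ0
    have h6 : inner ℝ w (z - y) = inner ℝ w (x₀ - y) - M * ‖w‖ := by
      rw [hz, show x₀ - (M * ‖w‖⁻¹) • w - y = (x₀ - y) - (M * ‖w‖⁻¹) • w by abel,
        inner_sub_right, real_inner_smul_right, real_inner_self_eq_norm_sq]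
      field_simp
    have h7 := hr.2 r₀ hr₀.1
    have h8 := hr₀.2 r hr.1
    have h9 := (abs_le.1 (hL r hr.1 r₀ hr₀.1)).1
    have h10 : (1 + a) * inner ℝ w (x₀ - y) = inner ℝ y₀ r - inner ℝ y₀ r₀
        - (inner ℝ y r - inner ℝ y r₀) := by
      rw [← inner_sub_right, ← inner_sub_right, ← inner_sub_left, real_inner_comm,
        ← real_inner_smul_left]
      congr 1
      rw [hy₀]; module
    have h11 : M * ‖w‖ ≤ inner ℝ w (x₀ - y) := by linarith
    have h12 : (1 + a) * (M * ‖w‖) ≤ L * ‖w‖ := by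
      have := mul_le_mul_of_nonneg_left h11 (by positivity : 0 ≤ 1 + a)
      have e : ‖r - r₀‖ = ‖w‖ := rfl
      rw [e] at h9
      linarith
    have h13 : L * ‖w‖ < M * ‖w‖ := mul_lt_mul_of_pos_right hLM hw
    nlinarith [mul_pos ha0 (mul_pos hM0 hw)]
  rw [hrr] at hr₀
  have hx : ∀ v, inner ℝ x₀ v = (1 - θ) * inner ℝ y₀ v + θ * inner ℝ y v := by
    intro v
    rw [hy₀, inner_sub_left, real_inner_smul_left, inner_sub_left]
    linear_combination (inner ℝ y v - inner ℝ x₀ v) * haθ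
  have huniq : ∀ p, IsMaximizer D (fun r => (1 - θ) * Ψ₀ r + θ * Ψ₁ r) x₀ p → p = r := by
    intro p hp
    refine hU₁.unique (hd₁ y hyM') ⟨hp.1, fun p' hp' => (hr.2 p' hp').trans ?_⟩ hr
    have h1 := mul_le_mul_of_nonneg_left (hr₀.2 p hp.1) hθ1'.le
    have h2 := hp.2 r hr.1
    simp only [hx] at h2
    have h3 : θ * (inner ℝ y r - Ψ₁ r) ≤ θ * (inner ℝ y p - Ψ₁ p) := by linarith
    exact le_of_mul_le_mul_left h3 hθ0
  rw [huniq p hp, huniq q hq]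

end Conjugate

end HopfFormula

namespace HopfFormula

/-! ### The effective domain of the Fenchel conjugate. -/

section Domain

variable {n : ℕ}

/-- The effective domain of the Fenchel conjugate of `σ`. -/
def conjDomain (σ : Rn n → ℝ) : Set (Rn n) :=
  {q | BddAbove (range fun x : Rn n => inner ℝ x q - σ x)}

/-- The real-valued Fenchel conjugate of `σ`, meaningful on `conjDomain σ`. -/
noncomputable def realConj (σ : Rn n → ℝ) (q : Rn n) : ℝ :=
  ⨆ x : Rn n, (inner ℝ x q - σ x)

/-- The time integral of the Hamiltonian. -/
noncomputable def timeIntegral (H : ℝ → Rn n → ℝ) (t : ℝ) (q : Rn n) : ℝ :=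
  ∫ τ in (0 : ℝ)..t, H τ q

variable {σ : Rn n → ℝ}

theorem le_realConj {q : Rn n} (hq : q ∈ conjDomain σ) (x : Rn n) :
    inner ℝ x q - σ x ≤ realConj σ q :=
  le_ciSup hq x

theorem mem_conjDomain_of_le {q : Rn n} {c : ℝ} (h : ∀ x, inner ℝ x q - σ x ≤ c) :
    q ∈ conjDomain σ :=
  ⟨c, by rintro _ ⟨x, rfl⟩; exact h x⟩

theorem realConj_le {q : Rn n} {c : ℝ} (h : ∀ x, inner ℝ x q - σ x ≤ c) : realConj σ q ≤ c :=
  ciSup_le h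

theorem fenchelConj_of_mem {q : Rn n} (hq : q ∈ conjDomain σ) :
    fenchelConj σ q = (realConj σ q : EReal) := by
  unfold fenchelConj
  refine le_antisymm (iSup_le fun x => EReal.coe_le_coe_iff.2 (le_realConj hq x)) ?_
  refine le_of_forall_lt fun c hc => ?_
  obtain ⟨a, ha, ha'⟩ := EReal.lt_iff_exists_real_btwn.1 hc
  obtain ⟨x, hx⟩ := exists_lt_of_lt_ciSup (EReal.coe_lt_coe_iff.1 ha')
  exact ha.trans ((EReal.coe_lt_coe_iff.2 hx).trans_le
    (le_iSup (fun x : Rn n => ((inner ℝ x q - σ x : ℝ) : EReal)) x))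

theorem fenchelConj_of_notMem {q : Rn n} (hq : q ∉ conjDomain σ) : fenchelConj σ q = ⊤ := by
  by_contra h
  refine hq (mem_conjDomain_of_le (c := (fenchelConj σ q).toReal) fun x => ?_)
  rw [← EReal.coe_le_coe_iff, EReal.coe_toReal h (fenchelConj_ne_bot σ q)]
  exact le_iSup (fun x : Rn n => ((inner ℝ x q - σ x : ℝ) : EReal)) x

/-- Along `x = m q` the expression `⟨x, q⟩ - σ x` grows at least like `m ‖q‖ (‖q‖ - K)`. -/
theorem norm_le_of_mem_conjDomain {K : NNReal} (hσ : LipschitzWith K σ) {q : Rn n}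
    (hq : q ∈ conjDomain σ) : ‖q‖ ≤ K := by
  by_contra! h
  have hq0 : 0 < ‖q‖ := K.2.trans_lt h
  have hpos : 0 < ‖q‖ * (‖q‖ - K) := mul_pos hq0 (sub_pos.2 h)
  obtain ⟨m, hm⟩ := exists_nat_gt ((realConj σ q + σ 0) / (‖q‖ * (‖q‖ - K)))
  rw [div_lt_iff₀ hpos] at hm
  have h1 := le_realConj hq ((m : ℝ) • q)
  have h2 := (abs_le.1 (hσ.dist_le_mul ((m : ℝ) • q) 0)).2
  rw [dist_zero_right, norm_smul, Real.norm_of_nonneg (Nat.cast_nonneg m)] at h2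
  rw [real_inner_smul_left, real_inner_self_eq_norm_sq] at h1
  nlinarith

/-- The domain need not be closed, so the minimization runs over all of `C` with values in `EReal`,
where a supremum of continuous functions is lower semicontinuous. Comparison with one point of the
domain then puts the minimizer in the domain. -/
theorem exists_isMaximizer_inter {C : Set (Rn n)} (hC : IsCompact C)
    (hne : (conjDomain σ ∩ C).Nonempty) {f : Rn n → ℝ} (hf : Continuous f) (y : Rn n) :
    ∃ q, IsMaximizer (conjDomain σ ∩ C) (fun q => realConj σ q + f q) y q := by
  have hlsc : LowerSemicontinuous fun q : Rn n =>
      ⨆ x : Rn n, ((inner ℝ x q - σ x + (f q - inner ℝ y q) : ℝ) : EReal) := by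
    refine lowerSemicontinuous_iSup fun x => Continuous.lowerSemicontinuous ?_
    exact continuous_coe_real_ereal.comp (by fun_prop)
  obtain ⟨p, hpD, hpC⟩ := hne
  obtain ⟨q, hqC, hq⟩ := (hlsc.lowerSemicontinuousOn C).exists_isMinOn ⟨p, hpC⟩ hC
  have key : ∀ p ∈ conjDomain σ ∩ C, ∀ x, inner ℝ x q - σ x ≤
      realConj σ p + (f p - inner ℝ y p) - (f q - inner ℝ y q) := by
    intro p hp x
    have h1 := (le_iSup (fun x : Rn n =>
      ((inner ℝ x q - σ x + (f q - inner ℝ y q) : ℝ) : EReal)) x).trans (hq hp.2)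
    have h2 : (⨆ x : Rn n, ((inner ℝ x p - σ x + (f p - inner ℝ y p) : ℝ) : EReal)) ≤
        ((realConj σ p + (f p - inner ℝ y p) : ℝ) : EReal) :=
      iSup_le fun x => EReal.coe_le_coe_iff.2 (by linarith [le_realConj hp.1 x])
    have := EReal.coe_le_coe_iff.1 (h1.trans h2)
    linarith
  have hqD := mem_conjDomain_of_le (key p ⟨hpD, hpC⟩)
  refine ⟨q, ⟨hqD, hqC⟩, fun p hp => ?_⟩
  have := realConj_le (key p hp)
  linarith

/-- A differentiable convex function is the conjugate of its Fenchel conjugate. -/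
theorem isConjugate_self (hσ : Differentiable ℝ σ) (hconv : ConvexOn ℝ univ σ) :
    IsConjugate (conjDomain σ) (realConj σ) σ := by
  intro y
  set q := (InnerProductSpace.toDual ℝ (Rn n)).symm (fderiv ℝ σ y) with hq
  have hqv : ∀ v, fderiv ℝ σ y v = inner ℝ v q := fun v => by
    rw [real_inner_comm, hq, InnerProductSpace.toDual_symm_apply]
  have htan : ∀ x, inner ℝ x q - σ x ≤ inner ℝ y q - σ y := by
    intro x
    have h1 := HasFDerivAt.hasDerivAt_line (hσ y).hasFDerivAt (x - y)
    have h2 := ((hasDerivAt_id (0 : ℝ)).mul_const (σ x - σ y)).sub h1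
    have := nonneg_of_hasDerivAt_of_min h2 (fun s hs => by
      have h3 := hconv.2 (mem_univ y) (mem_univ x) (sub_nonneg.2 hs.2) hs.1 (by ring)
      have e : (1 - s) • y + s • x = y + s • (x - y) := by module
      rw [e, smul_eq_mul, smul_eq_mul] at h3
      simp only [Pi.sub_apply, zero_smul, add_zero, id, zero_mul]
      linarith)
    rw [hqv, inner_sub_left] at this
    linarith
  have hD := mem_conjDomain_of_le htan
  have he : realConj σ q = inner ℝ y q - σ y := le_antisymm (realConj_le htan) (le_realConj hD y)
  exact ⟨q, ⟨hD, fun p hp => by linarith [le_realConj hp y]⟩, by linarith⟩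

end Domain

/-! ### Regularity and structure of the time integral of `H`. -/

section Hamiltonian

variable {n : ℕ} {T : ℝ} {H : ℝ → Rn n → ℝ} {σ : Rn n → ℝ}

theorem exists_lipschitz_hamiltonian
    (hH : ContDiffOn ℝ 1 (fun z : ℝ × Rn n => H z.1 z.2) (Icc 0 T ×ˢ (univ : Set (Rn n))))
    (R : ℝ) : ∃ L : ℝ, 0 ≤ L ∧ ∀ τ ∈ Icc 0 T, ∀ p q : Rn n, ‖p‖ ≤ R → ‖q‖ ≤ R →
      |H τ p - H τ q| ≤ L * ‖p - q‖ := by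
  obtain ⟨L, hL⟩ := (hH.mono (prod_mono_right (subset_univ
    (Metric.closedBall (0 : Rn n) R)))).exists_lipschitzOnWith one_ne_zero
    ((convex_Icc 0 T).prod (convex_closedBall _ _)) (isCompact_Icc.prod (isCompact_closedBall _ _))
  refine ⟨L, L.2, fun τ hτ p q hp hq => ?_⟩
  have := hL.dist_le_mul (τ, p) ⟨hτ, by simpa using hp⟩ (τ, q) ⟨hτ, by simpa using hq⟩
  rwa [Real.dist_eq, Prod.dist_eq, dist_self, dist_eq_norm, max_eq_right (norm_nonneg _)] at this

variable (hH : ContinuousOn (fun z : ℝ × Rn n => H z.1 z.2) (Icc 0 T ×ˢ (univ : Set (Rn n))))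

include hH

theorem intervalIntegrable_hamiltonian {a b : ℝ} (ha : a ∈ Icc 0 T) (hb : b ∈ Icc 0 T)
    (q : Rn n) : IntervalIntegrable (fun τ => H τ q) MeasureTheory.volume a b := by
  refine ContinuousOn.intervalIntegrable ?_
  refine hH.comp (f := fun τ : ℝ => (τ, q)) (by fun_prop) fun τ hτ => ⟨?_, mem_univ _⟩
  exact uIcc_subset_Icc ha hb hτ

theorem timeIntegral_sub {a b : ℝ} (ha : a ∈ Icc 0 T) (hb : b ∈ Icc 0 T) (q : Rn n) :
    timeIntegral H b q - timeIntegral H a q = ∫ τ in a..b, H τ q := by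
  have h0 : (0 : ℝ) ∈ Icc 0 T := ⟨le_rfl, ha.1.trans ha.2⟩
  exact intervalIntegral.integral_interval_sub_left
    (intervalIntegrable_hamiltonian hH h0 hb q) (intervalIntegrable_hamiltonian hH h0 ha q)

theorem lipschitz_timeIntegral {R L : ℝ} (hL0 : 0 ≤ L)
    (hL : ∀ τ ∈ Icc 0 T, ∀ p q : Rn n, ‖p‖ ≤ R → ‖q‖ ≤ R → |H τ p - H τ q| ≤ L * ‖p - q‖)
    {a b : ℝ} (ha : a ∈ Icc 0 T) (hb : b ∈ Icc 0 T) {p q : Rn n} (hp : ‖p‖ ≤ R)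
    (hq : ‖q‖ ≤ R) :
    |(timeIntegral H b p - timeIntegral H a p) - (timeIntegral H b q - timeIntegral H a q)| ≤
      T * L * ‖p - q‖ := by
  rw [timeIntegral_sub hH ha hb, timeIntegral_sub hH ha hb, ← intervalIntegral.integral_sub
    (intervalIntegrable_hamiltonian hH ha hb p) (intervalIntegrable_hamiltonian hH ha hb q)]
  have h1 := intervalIntegral.norm_integral_le_of_norm_le_const (a := a) (b := b)
    (f := fun τ => H τ p - H τ q) (C := L * ‖p - q‖)
    (fun τ hτ => hL τ (uIcc_subset_Icc ha hb (uIoc_subset_uIcc hτ)) p q hp hq)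
  have h2 : |b - a| ≤ T := abs_le.2 ⟨by linarith [ha.2, hb.1], by linarith [hb.2, ha.1]⟩
  rw [Real.norm_eq_abs] at h1
  refine h1.trans ?_
  have := mul_le_mul_of_nonneg_left h2 (mul_nonneg hL0 (norm_nonneg (p - q)))
  linarith

omit hH in
theorem timeIntegral_zero (q : Rn n) : timeIntegral H 0 q = 0 := by
  simp [timeIntegral]

theorem continuous_timeIntegral
    (hL : ∀ R, ∃ L : ℝ, 0 ≤ L ∧ ∀ τ ∈ Icc 0 T, ∀ p q : Rn n, ‖p‖ ≤ R → ‖q‖ ≤ R →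
      |H τ p - H τ q| ≤ L * ‖p - q‖) {t : ℝ} (ht : t ∈ Icc 0 T) :
    Continuous (timeIntegral H t) := by
  refine continuous_iff_continuousAt.2 fun q₀ => ?_
  obtain ⟨L, hL0, hL⟩ := hL (‖q₀‖ + 1)
  have h0 : (0 : ℝ) ∈ Icc 0 T := ⟨le_rfl, ht.1.trans ht.2⟩
  have hlip : LipschitzOnWith (T * L).toNNReal (timeIntegral H t)
      (Metric.closedBall 0 (‖q₀‖ + 1)) := LipschitzOnWith.of_dist_le_mul fun p hp q hq => by
    have := lipschitz_timeIntegral hH hL0 hL h0 ht (by simpa using hp) (by simpa using hq)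
    simp only [timeIntegral_zero, sub_zero] at this
    rwa [Real.dist_eq, dist_eq_norm, Real.coe_toNNReal _ (mul_nonneg (ht.1.trans ht.2) hL0)]
  refine hlip.continuousOn.continuousAt (Filter.mem_of_superset
    (Metric.ball_mem_nhds q₀ one_pos) fun q hq => ?_)
  rw [mem_ball_iff_norm] at hq
  have := norm_sub_norm_le q q₀
  simp only [Metric.mem_closedBall, dist_zero_right]
  linarith

theorem convexOn_timeIntegral_sub (hconv : ∀ t ∈ Ioo 0 T, ConvexOn ℝ univ (H t)) {a b : ℝ}
    (ha : a ∈ Icc 0 T) (hb : b ∈ Icc 0 T) (hab : a ≤ b) :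
    ConvexOn ℝ univ fun q => timeIntegral H b q - timeIntegral H a q := by
  refine ⟨convex_univ, fun x _ y _ c d hc hd hcd => ?_⟩
  have hi := intervalIntegrable_hamiltonian hH ha hb
  simp only [timeIntegral_sub hH ha hb, smul_eq_mul]
  rw [← intervalIntegral.integral_const_mul, ← intervalIntegral.integral_const_mul,
    ← intervalIntegral.integral_add ((hi x).const_mul c) ((hi y).const_mul d)]
  refine intervalIntegral.integral_mono_on_of_le_Ioo hab (hi _)
    (((hi x).const_mul c).add ((hi y).const_mul d)) fun τ hτ => ?_
  exact (hconv τ ⟨ha.1.trans_lt hτ.1, hτ.2.trans_le hb.2⟩).2 (mem_univ x) (mem_univ y) hc hd hcd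

theorem concaveOn_timeIntegral_sub (hconc : ∀ t ∈ Ioo 0 T, ConcaveOn ℝ univ (H t)) {a b : ℝ}
    (ha : a ∈ Icc 0 T) (hb : b ∈ Icc 0 T) (hab : a ≤ b) :
    ConcaveOn ℝ univ fun q => timeIntegral H b q - timeIntegral H a q := by
  refine ⟨convex_univ, fun x _ y _ c d hc hd hcd => ?_⟩
  have hi := intervalIntegrable_hamiltonian hH ha hb
  simp only [timeIntegral_sub hH ha hb, smul_eq_mul]
  rw [← intervalIntegral.integral_const_mul, ← intervalIntegral.integral_const_mul,
    ← intervalIntegral.integral_add ((hi x).const_mul c) ((hi y).const_mul d)]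
  refine intervalIntegral.integral_mono_on_of_le_Ioo hab
    (((hi x).const_mul c).add ((hi y).const_mul d)) (hi _) fun τ hτ => ?_
  exact (hconc τ ⟨ha.1.trans_lt hτ.1, hτ.2.trans_le hb.2⟩).2 (mem_univ x) (mem_univ y) hc hd hcd

/-- For a separable Hamiltonian whose time factor does not change sign, the earlier integral is
a fraction of the later one, up to a constant. -/
theorem exists_timeIntegral_eq_mul_add {g k : ℝ → ℝ} {h : Rn n → ℝ}
    (hg : ∀ t ∈ Ioo 0 T, ∀ p : Rn n, H t p = g t * h p + k t)
    (hsgn : (∀ t ∈ Ioo 0 T, 0 ≤ g t) ∨ (∀ t ∈ Ioo 0 T, g t ≤ 0)) {a b : ℝ}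
    (ha : a ∈ Icc 0 T) (hb : b ∈ Icc 0 T) (hab : a ≤ b) :
    ∃ θ ∈ Icc (0 : ℝ) 1, ∃ c : ℝ, ∀ q, timeIntegral H a q = θ * timeIntegral H b q + c := by
  have h0 : (0 : ℝ) ∈ Icc 0 T := ⟨le_rfl, ha.1.trans ha.2⟩
  have hdiff : ∀ s ∈ Icc 0 T, ∀ t ∈ Icc 0 T, s ≤ t → ∀ p q : Rn n,
      (timeIntegral H t p - timeIntegral H s p) - (timeIntegral H t q - timeIntegral H s q) =
        ∫ τ in s..t, (H τ p - H τ q) := fun s hs t ht _ p q => by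
    rw [timeIntegral_sub hH hs ht, timeIntegral_sub hH hs ht, ← intervalIntegral.integral_sub
      (intervalIntegrable_hamiltonian hH hs ht p) (intervalIntegrable_hamiltonian hH hs ht q)]
  by_cases hconst : ∃ p₁ p₂, h p₁ ≠ h p₂
  · obtain ⟨p₁, p₂, hne⟩ := hconst
    have hne' : h p₁ - h p₂ ≠ 0 := sub_ne_zero.2 hne
    -- the integral of `g`, expressed through the integrable function `H`
    set γ : ℝ → ℝ := fun t => (h p₁ - h p₂)⁻¹ * (timeIntegral H t p₁ - timeIntegral H t p₂)
    have hγ : ∀ t ∈ Icc 0 T, ∀ q,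
        timeIntegral H t q - timeIntegral H t p₂ = γ t * (h q - h p₂) := by
      intro t ht q
      have e1 := hdiff 0 h0 t ht ht.1 q p₂
      have e2 := hdiff 0 h0 t ht ht.1 p₁ p₂
      simp only [timeIntegral_zero, sub_zero] at e1 e2
      simp only [γ]
      -- The factorization of `H` is known only for times in the open interval, hence the passage to
      -- `Ioo`.
      rw [e1, e2, mul_comm, ← mul_assoc, ← intervalIntegral.integral_const_mul,
        intervalIntegral.integral_of_le ht.1, intervalIntegral.integral_of_le ht.1,
        MeasureTheory.integral_Ioc_eq_integral_Ioo, MeasureTheory.integral_Ioc_eq_integral_Ioo]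
      refine MeasureTheory.setIntegral_congr_fun measurableSet_Ioo fun τ hτ => ?_
      have hτ' : τ ∈ Ioo 0 T := ⟨hτ.1, hτ.2.trans_le ht.2⟩
      simp only [hg τ hτ']
      field_simp
      ring
    have hγg : ∀ s ∈ Icc 0 T, ∀ t ∈ Icc 0 T, s ≤ t → γ t - γ s = ∫ τ in Ioo s t, g τ := by
      intro s hs t ht hst
      have e := hdiff s hs t ht hst p₁ p₂
      have : γ t - γ s = (h p₁ - h p₂)⁻¹ * ∫ τ in s..t, (H τ p₁ - H τ p₂) := by
        rw [← e]; simp only [γ]; ring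
      rw [this, ← intervalIntegral.integral_const_mul, intervalIntegral.integral_of_le hst,
        MeasureTheory.integral_Ioc_eq_integral_Ioo]
      refine MeasureTheory.setIntegral_congr_fun measurableSet_Ioo fun τ hτ => ?_
      have hτ' : τ ∈ Ioo 0 T := ⟨hs.1.trans_lt hτ.1, hτ.2.trans_le ht.2⟩
      simp only [hg τ hτ']
      field_simp
      ring
    have hγ0 : γ 0 = 0 := by simp [γ, timeIntegral_zero]
    have hθ : ∃ θ ∈ Icc (0 : ℝ) 1, γ a = θ * γ b := by
      have e1 := hγg 0 h0 a ha ha.1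
      have e2 := hγg a ha b hb hab
      rw [hγ0, sub_zero] at e1
      have hsub1 : ∀ τ ∈ Ioo 0 a, τ ∈ Ioo 0 T := fun τ hτ => ⟨hτ.1, hτ.2.trans_le ha.2⟩
      have hsub2 : ∀ τ ∈ Ioo a b, τ ∈ Ioo 0 T := fun τ hτ =>
        ⟨ha.1.trans_lt hτ.1, hτ.2.trans_le hb.2⟩
      -- `γ a` and `γ b - γ a` have the same sign, so `γ b = 0` forces `γ a = 0`; otherwise `γ a / γ
      -- b` lies in `[0, 1]`.
      rcases eq_or_ne (γ b) 0 with hb0 | hb0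
      · refine ⟨0, by simp, ?_⟩
        rcases hsgn with hs | hs
        · have i1 := MeasureTheory.setIntegral_nonneg (μ := MeasureTheory.volume)
            measurableSet_Ioo fun τ hτ => hs τ (hsub1 τ hτ)
          have i2 := MeasureTheory.setIntegral_nonneg (μ := MeasureTheory.volume)
            measurableSet_Ioo fun τ hτ => hs τ (hsub2 τ hτ)
          linarith
        · have i1 := MeasureTheory.setIntegral_nonpos (μ := MeasureTheory.volume)
            measurableSet_Ioo fun τ hτ => hs τ (hsub1 τ hτ)
          have i2 := MeasureTheory.setIntegral_nonpos (μ := MeasureTheory.volume)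
            measurableSet_Ioo fun τ hτ => hs τ (hsub2 τ hτ)
          linarith
      · refine ⟨γ a / γ b, ?_, by field_simp⟩
        rcases hsgn with hs | hs
        · have i1 := MeasureTheory.setIntegral_nonneg (μ := MeasureTheory.volume)
            measurableSet_Ioo fun τ hτ => hs τ (hsub1 τ hτ)
          have i2 := MeasureTheory.setIntegral_nonneg (μ := MeasureTheory.volume)
            measurableSet_Ioo fun τ hτ => hs τ (hsub2 τ hτ)
          exact ⟨div_nonneg (by linarith) (by linarith),
            div_le_one_of_le₀ (by linarith) (by linarith)⟩
        · have i1 := MeasureTheory.setIntegral_nonpos (μ := MeasureTheory.volume)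
            measurableSet_Ioo fun τ hτ => hs τ (hsub1 τ hτ)
          have i2 := MeasureTheory.setIntegral_nonpos (μ := MeasureTheory.volume)
            measurableSet_Ioo fun τ hτ => hs τ (hsub2 τ hτ)
          exact ⟨div_nonneg_of_nonpos (by linarith) (by linarith),
            div_le_one_of_ge (by linarith) (by linarith)⟩
    obtain ⟨θ, hθ, e⟩ := hθ
    refine ⟨θ, hθ, timeIntegral H a p₂ - θ * timeIntegral H b p₂, fun q => ?_⟩
    have e1 := hγ a ha q
    have e2 := hγ b hb q
    rw [e] at e1
    linear_combination e1 - θ * e2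
  · push Not at hconst
    refine ⟨0, by simp, timeIntegral H a 0, fun q => ?_⟩
    have e := hdiff 0 h0 a ha ha.1 q 0
    simp only [timeIntegral_zero, sub_zero] at e
    have : ∫ τ in (0 : ℝ)..a, (H τ q - H τ 0) = 0 := by
      rw [intervalIntegral.integral_of_le ha.1, MeasureTheory.integral_Ioc_eq_integral_Ioo]
      refine MeasureTheory.setIntegral_eq_zero_of_forall_eq_zero fun τ hτ => ?_
      have hτ' : τ ∈ Ioo 0 T := ⟨hτ.1, hτ.2.trans_le ha.2⟩
      rw [hg τ hτ', hg τ hτ', hconst q 0, sub_self]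
    linarith

end Hamiltonian

end HopfFormula

namespace HopfFormula

/-! ### The Hopf formula: maximizers and joint differentiability. -/

section Value

variable {n : ℕ} {H : ℝ → Rn n → ℝ} {σ : Rn n → ℝ}

theorem hopf_eq_of_isMaximizer {t : ℝ} {x q : Rn n}
    (hq : IsMaximizer (conjDomain σ) (fun p => realConj σ p + timeIntegral H t p) x q) :
    hopf H σ (t, x) = inner ℝ x q - (realConj σ q + timeIntegral H t q) := by
  have hval : ∀ p ∈ conjDomain σ, phi H σ t x p =
      ((inner ℝ x p - (realConj σ p + timeIntegral H t p) : ℝ) : EReal) := fun p hp => by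
    unfold phi
    rw [fenchelConj_of_mem hp, ← EReal.coe_sub, timeIntegral]
    congr 1; ring
  have : (⨆ p, phi H σ t x p) = phi H σ t x q := by
    refine le_antisymm (iSup_le fun p => ?_) (le_iSup (phi H σ t x) q)
    by_cases hp : p ∈ conjDomain σ
    · rw [hval p hp, hval q hq.1]
      exact EReal.coe_le_coe_iff.2 (hq.2 p hp)
    · unfold phi
      rw [fenchelConj_of_notMem hp, EReal.sub_top]
      exact bot_le
  unfold hopf
  simp only [this, hval q hq.1, EReal.toReal_coe]

/-- Since `σ` is Lipschitz, the effective domain of its conjugate is bounded, so the maximum in the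
Hopf formula is attained without any further assumption. -/
theorem isConjugate_hopf {K : NNReal} (hK : LipschitzWith K σ)
    (hne : (conjDomain σ).Nonempty) {t : ℝ} (hc : Continuous (timeIntegral H t)) :
    IsConjugate (conjDomain σ) (fun p => realConj σ p + timeIntegral H t p)
      (fun x => hopf H σ (t, x)) := by
  have hsub : conjDomain σ ∩ Metric.closedBall 0 K = conjDomain σ :=
    inter_eq_left.2 fun q hq => by simpa using norm_le_of_mem_conjDomain hK hq
  intro x
  obtain ⟨q, hq⟩ := exists_isMaximizer_inter (isCompact_closedBall (0 : Rn n) K)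
    (by rwa [hsub]) hc x
  rw [hsub] at hq
  exact ⟨q, hq, hopf_eq_of_isMaximizer hq⟩

variable {T : ℝ} (hH : ContinuousOn (fun z : ℝ × Rn n => H z.1 z.2)
  (Icc 0 T ×ˢ (univ : Set (Rn n))))

include hH

theorem exists_bound_hamiltonian (R : ℝ) : ∃ B : ℝ, 0 ≤ B ∧ ∀ τ ∈ Icc 0 T, ∀ q : Rn n,
    ‖q‖ ≤ R → |H τ q| ≤ B := by
  obtain ⟨B, hB⟩ := (isCompact_Icc.prod (isCompact_closedBall (0 : Rn n) R)).exists_bound_of_continuousOn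
    (hH.mono (prod_mono_right (subset_univ _)))
  exact ⟨max B 0, le_max_right _ _, fun τ hτ q hq =>
    (hB (τ, q) ⟨hτ, by simpa using hq⟩).trans (le_max_left _ _)⟩

/-- Maximizers converge to the maximizer at a point where it is unique. -/
theorem eventually_norm_isMaximizer_sub_lt {K : NNReal} (hK : LipschitzWith K σ)
    (hc : ∀ t ∈ Icc 0 T, Continuous (timeIntegral H t)) {t₀ : ℝ} {x₀ q₀ : Rn n}
    (ht₀ : t₀ ∈ Ioo 0 T)
    (hq₀ : IsMaximizer (conjDomain σ) (fun p => realConj σ p + timeIntegral H t₀ p) x₀ q₀)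
    (huniq : ∀ q, IsMaximizer (conjDomain σ) (fun p => realConj σ p + timeIntegral H t₀ p) x₀ q →
      q = q₀) {δ : ℝ} (hδ : 0 < δ) :
    ∃ η > 0, ∀ t ∈ Icc 0 T, ∀ x : Rn n, |t - t₀| < η → ‖x - x₀‖ < η → ∀ q,
      IsMaximizer (conjDomain σ) (fun p => realConj σ p + timeIntegral H t p) x q →
        ‖q - q₀‖ < δ := by
  have ht₀' := Ioo_subset_Icc_self ht₀
  set C : Set (Rn n) := Metric.closedBall 0 K ∩ {q | δ ≤ ‖q - q₀‖} with hC
  have hCc : IsCompact C := (isCompact_closedBall _ _).inter_right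
    (isClosed_le continuous_const (by fun_prop))
  by_cases hne : (conjDomain σ ∩ C).Nonempty
  · obtain ⟨m, hm⟩ := exists_isMaximizer_inter hCc hne (hc t₀ ht₀') x₀
    have hgap : inner ℝ x₀ m - (realConj σ m + timeIntegral H t₀ m) <
        inner ℝ x₀ q₀ - (realConj σ q₀ + timeIntegral H t₀ q₀) := by
      by_contra! hle
      have := huniq m ⟨hm.1.1, fun p hp => (hq₀.2 p hp).trans hle⟩
      have h2 : δ ≤ ‖m - q₀‖ := hm.1.2.2
      rw [this, sub_self, norm_zero] at h2
      linarith
    obtain ⟨B, hB0, hB⟩ := exists_bound_hamiltonian hH K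
    set gap := inner ℝ x₀ q₀ - (realConj σ q₀ + timeIntegral H t₀ q₀) -
      (inner ℝ x₀ m - (realConj σ m + timeIntegral H t₀ m)) with hgapdef
    have hgap0 : 0 < gap := sub_pos.2 hgap
    have hKB : 0 < 2 * ((K : ℝ) + B + 1) := by have := K.2; positivity
    -- Moving from `(t₀, x₀)` to `(t, x)` changes the objective at `q` and at `q₀` by at most `B |t
    -- - t₀| + K ‖x - x₀‖` each. With this radius, each change is less than `gap / 2`.
    refine ⟨gap / (2 * (K + B + 1)), div_pos hgap0 hKB, fun t ht x htη hxη q hq => ?_⟩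
    by_contra! hfar
    have hqK := norm_le_of_mem_conjDomain hK hq.1
    have hq₀K := norm_le_of_mem_conjDomain hK hq₀.1
    have h1 := hm.2 q ⟨hq.1, by simpa using hqK, hfar⟩
    have h2 := hq.2 q₀ hq₀.1
    have hint : ∀ p : Rn n, ‖p‖ ≤ K →
        |timeIntegral H t p - timeIntegral H t₀ p| ≤ B * |t - t₀| := fun p hp => by
      rw [timeIntegral_sub hH ht₀' ht]
      exact intervalIntegral.norm_integral_le_of_norm_le_const (f := fun τ => H τ p)
        fun τ hτ => hB τ (uIcc_subset_Icc ht₀' ht (uIoc_subset_uIcc hτ)) p hp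
    have hin : ∀ p : Rn n, ‖p‖ ≤ K → |inner ℝ x p - inner ℝ x₀ p| ≤ K * ‖x - x₀‖ :=
      fun p hp => by
        rw [← inner_sub_left, mul_comm]
        exact (abs_real_inner_le_norm _ _).trans
          (mul_le_mul_of_nonneg_left hp (norm_nonneg _))
    have i1 := (abs_le.1 (hint q hqK)).1
    have i2 := (abs_le.1 (hint q₀ hq₀K)).2
    have i3 := (abs_le.1 (hin q hqK)).2
    have i4 := (abs_le.1 (hin q₀ hq₀K)).1
    rw [lt_div_iff₀ hKB] at htη hxη
    have hk : 0 ≤ (K : ℝ) := K.2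
    nlinarith [mul_nonneg hk (abs_nonneg (t - t₀)), mul_nonneg hB0 (norm_nonneg (x - x₀)),
      abs_nonneg (t - t₀), norm_nonneg (x - x₀), mul_nonneg hB0 (abs_nonneg (t - t₀)),
      mul_nonneg hk (norm_nonneg (x - x₀))]
  · refine ⟨1, one_pos, fun t _ x _ _ q hq => ?_⟩
    by_contra! hfar
    exact hne ⟨q, hq.1, by simpa using norm_le_of_mem_conjDomain hK hq.1, hfar⟩

/-- The Hopf formula is differentiable wherever the maximizer is unique. -/
theorem differentiableAt_hopf_of_unique {K : NNReal} (hK : LipschitzWith K σ)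
    (hc : ∀ t ∈ Icc 0 T, Continuous (timeIntegral H t)) {t₀ : ℝ} {x₀ q₀ : Rn n}
    (ht₀ : t₀ ∈ Ioo 0 T)
    (hq₀ : IsMaximizer (conjDomain σ) (fun p => realConj σ p + timeIntegral H t₀ p) x₀ q₀)
    (huniq : ∀ q, IsMaximizer (conjDomain σ) (fun p => realConj σ p + timeIntegral H t₀ p) x₀ q →
      q = q₀) : DifferentiableAt ℝ (hopf H σ) (t₀, x₀) := by
  have ht₀' := Ioo_subset_Icc_self ht₀
  have hconj := fun t (ht : t ∈ Icc 0 T) => isConjugate_hopf (H := H) hK ⟨q₀, hq₀.1⟩ (hc t ht)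
  set A : ℝ × Rn n →L[ℝ] ℝ := (innerSL ℝ q₀).comp (ContinuousLinearMap.snd ℝ ℝ (Rn n)) -
    H t₀ q₀ • ContinuousLinearMap.fst ℝ ℝ (Rn n) with hA
  suffices HasFDerivAt (hopf H σ) A (t₀, x₀) from this.differentiableAt
  rw [hasFDerivAt_iff_isLittleO, Asymptotics.isLittleO_iff]
  intro ε hε
  have hcont : ContinuousAt (fun z : ℝ × Rn n => H z.1 z.2) (t₀, q₀) :=
    hH.continuousAt (prod_mem_nhds (Icc_mem_nhds ht₀.1 ht₀.2) Filter.univ_mem)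
  obtain ⟨δ, hδ, hclose⟩ := Metric.continuousAt_iff.1 hcont (ε / 2) (half_pos hε)
  obtain ⟨η, hη, hmax⟩ := eventually_norm_isMaximizer_sub_lt hH hK hc ht₀ hq₀ huniq
    (lt_min hδ (half_pos hε))
  have hnhds : Metric.ball t₀ (min δ η) ∩ Ioo 0 T ∈ nhds t₀ :=
    Filter.inter_mem (Metric.ball_mem_nhds _ (lt_min hδ hη)) (Ioo_mem_nhds ht₀.1 ht₀.2)
  filter_upwards [prod_mem_nhds hnhds (Metric.ball_mem_nhds x₀ hη)]
  rintro ⟨t, x⟩ ⟨⟨htb, ht⟩, hxb⟩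
  simp only [Metric.mem_ball, dist_eq_norm] at htb hxb ht
  have ht' := Ioo_subset_Icc_self ht
  obtain ⟨q, hq, hux⟩ := hconj t ht' x
  have hu₀ := hopf_eq_of_isMaximizer hq₀
  have hqclose := hmax t ht' x (htb.trans_le (min_le_right _ _)) hxb q hq
  have hint : ∀ p : Rn n, ‖p - q₀‖ < δ →
      |timeIntegral H t p - timeIntegral H t₀ p - H t₀ q₀ * (t - t₀)| ≤ ε / 2 * |t - t₀| := by
    intro p hp
    have e : timeIntegral H t p - timeIntegral H t₀ p - H t₀ q₀ * (t - t₀) =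
        ∫ τ in t₀..t, (H τ p - H t₀ q₀) := by
      rw [timeIntegral_sub hH ht₀' ht', intervalIntegral.integral_sub
        (intervalIntegrable_hamiltonian hH ht₀' ht' p) intervalIntegrable_const,
        intervalIntegral.integral_const, smul_eq_mul, mul_comm]
    rw [e]
    refine intervalIntegral.norm_integral_le_of_norm_le_const
      (f := fun τ => H τ p - H t₀ q₀) fun τ hτ => ?_
    have hτt : |τ - t₀| ≤ |t - t₀| := by
      have := abs_sub_left_of_mem_uIcc (uIoc_subset_uIcc hτ)
      exact this
    have := @hclose (τ, p) (by
      rw [Prod.dist_eq, Real.dist_eq, dist_eq_norm]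
      exact max_lt (hτt.trans_lt (htb.trans_le (min_le_left _ _))) hp)
    rw [Real.dist_eq] at this
    exact this.le
  have i1 := abs_le.1 (hint q (hqclose.trans_le (min_le_left _ _)))
  have i2 := abs_le.1 (hint q₀ (by simpa using hδ))
  -- The lower estimate uses `q₀` as competitor at `(t, x)`; the upper one uses the nearby maximizer
  -- `q` as competitor at `(t₀, x₀)`.
  have h1 : inner ℝ x q₀ - (realConj σ q₀ + timeIntegral H t q₀) ≤ hopf H σ (t, x) :=
    (hconj t ht').le x hq₀.1
  have h2 := hq₀.2 q hq.1
  have h3 : inner ℝ (x - x₀) (q - q₀) ≤ ε / 2 * ‖x - x₀‖ := by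
    refine (real_inner_le_norm _ _).trans ?_
    rw [mul_comm]
    exact mul_le_mul_of_nonneg_right (hqclose.le.trans (min_le_right _ _)) (norm_nonneg _)
  rw [inner_sub_left, inner_sub_right, inner_sub_right] at h3
  have hAz : A ((t, x) - (t₀, x₀)) = inner ℝ x q₀ - inner ℝ x₀ q₀ - H t₀ q₀ * (t - t₀) := by
    rw [← inner_sub_left, real_inner_comm]
    simp [hA]
  have hn1 : |t - t₀| ≤ ‖(t, x) - (t₀, x₀)‖ := le_max_left _ _
  have hn2 : ‖x - x₀‖ ≤ ‖(t, x) - (t₀, x₀)‖ := le_max_right _ _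
  have hn1' := mul_le_mul_of_nonneg_left hn1 (half_pos hε).le
  have hn2' := mul_le_mul_of_nonneg_left hn2 (half_pos hε).le
  have hn0 := mul_nonneg (half_pos hε).le (norm_nonneg ((t, x) - (t₀, x₀)))
  have hux' : hopf H σ (t, x) = inner ℝ x q - (realConj σ q + timeIntegral H t q) := hux
  rw [hAz, Real.norm_eq_abs, abs_le]
  constructor <;> linarith [i1.1, i1.2, i2.1, i2.2]

end Value

/-! ### Regularity passes backward in time. -/

section Propagation

variable {n : ℕ} {T : ℝ} {H : ℝ → Rn n → ℝ} {σ : Rn n → ℝ}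

/-- If all points of a large ball at the later time `t₁` are regular, then so is `(t₀, x₀)`. -/
theorem exists_radius_forall_differentiableAt (hT : 0 < T)
    (hH : ContDiffOn ℝ 1 (fun z : ℝ × Rn n => H z.1 z.2) (Icc 0 T ×ˢ (univ : Set (Rn n))))
    (hσ : Differentiable ℝ σ) (hσconv : ConvexOn ℝ univ σ) {K : NNReal}
    (hK : LipschitzWith K σ) (hA2 : AssumptionA2 T H) :
    ∃ M : ℝ, ∀ t₀ ∈ Ioo 0 T, ∀ x₀ : Rn n, ∀ t₁ ∈ Ioc t₀ T,
      (∀ x, ‖x - x₀‖ ≤ M → DifferentiableAt ℝ (fun y => hopf H σ (t₁, y)) x) →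
        DifferentiableAt ℝ (hopf H σ) (t₀, x₀) := by
  have hHc := hH.continuousOn
  have hc : ∀ t ∈ Icc 0 T, Continuous (timeIntegral H t) := fun t ht =>
    continuous_timeIntegral hHc (exists_lipschitz_hamiltonian hH) ht
  have hself := isConjugate_self hσ hσconv
  obtain ⟨q, hq, -⟩ := hself 0
  have hne : (conjDomain σ).Nonempty := ⟨q, hq.1⟩
  have hDK : ∀ q ∈ conjDomain σ, ‖q‖ ≤ K := fun q hq => norm_le_of_mem_conjDomain hK hq
  obtain ⟨L, hL0, hL⟩ := exists_lipschitz_hamiltonian hH (K + 1)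
  have hTL : 0 ≤ T * L := mul_nonneg hT.le hL0
  have hzero : (0 : ℝ) ∈ Icc 0 T := ⟨le_rfl, hT.le⟩
  -- `T * L` is a Lipschitz constant for differences of time integrals; the extra `1` gives the
  -- strict inequality required in the separable case.
  refine ⟨T * L + 1, fun t₀ ht₀ x₀ t₁ ht₁ hd => ?_⟩
  have ht₀' := Ioo_subset_Icc_self ht₀
  have ht₁' : t₁ ∈ Icc 0 T := ⟨ht₀.1.le.trans ht₁.1.le, ht₁.2⟩
  have hconj := isConjugate_hopf (H := H) hK hne (hc t₁ ht₁')
  obtain ⟨q₀, hq₀, -⟩ := isConjugate_hopf (H := H) hK hne (hc t₀ ht₀') x₀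
  refine differentiableAt_hopf_of_unique hHc hK hc ht₀ hq₀ fun q hq => ?_
  rcases hA2 with (hconvex | hconcave) | ⟨g, h, k, hg, hsgn⟩
  -- Here the comparison is with time `0`: `σ* = Ψ_{t₀} + G` with `G = -∫₀^{t₀} H` concave, and the
  -- conjugate `σ` is differentiable everywhere.
  · have hcv := convexOn_timeIntegral_sub hHc hconvex hzero ht₀' ht₀'.1
    refine isMaximizer_unique_of_add_concave (G := fun p => -(timeIntegral H t₀ p))
      (L := T * L) (M := T * L) hDK (fun p _ => by ring) hself ?_ (hc t₀ ht₀').neg hTL ?_ le_rfl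
      (fun y _ => hσ y) hq hq₀
    · simp only [timeIntegral_zero, sub_zero] at hcv
      exact hcv.neg
    · intro p r hp hr
      have := lipschitz_timeIntegral hHc hL0 hL hzero ht₀' hp hr
      simp only [timeIntegral_zero, sub_zero] at this
      rwa [neg_sub_neg, abs_sub_comm]
  · exact isMaximizer_unique_of_add_concave
      (G := fun p => timeIntegral H t₁ p - timeIntegral H t₀ p) (L := T * L) hDK
      (fun p _ => by ring) hconj (concaveOn_timeIntegral_sub hHc hconcave ht₀' ht₁' ht₁.1.le)
      ((hc t₁ ht₁').sub (hc t₀ ht₀')) hTL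
      (fun p r hp hr => lipschitz_timeIntegral hHc hL0 hL ht₀' ht₁' hp hr)
      (le_add_of_nonneg_right zero_le_one) hd hq hq₀
  · obtain ⟨θ, hθ, c, hθc⟩ := exists_timeIntegral_eq_mul_add hHc hg hsgn ht₀' ht₁' ht₁.1.le
    -- For `θ = 0` or `θ = 1`, `Ψ_{t₀}` is `Ψ_0` or `Ψ_{t₁}` up to a constant, and differentiability
    -- at `x₀` itself suffices.
    rcases eq_or_lt_of_le hθ.1 with h0 | h0
    · refine hself.unique (hσ x₀) (hq.congr_const (-c) fun p _ => ?_)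
        (hq₀.congr_const (-c) fun p _ => ?_) <;> rw [hθc p, ← h0] <;> ring
    rcases eq_or_lt_of_le hθ.2 with h1 | h1
    · refine hconj.unique (hd x₀ (by simp; positivity)) (hq.congr_const (-c) fun p _ => ?_)
        (hq₀.congr_const (-c) fun p _ => ?_) <;> rw [hθc p, h1] <;> ring
    refine isMaximizer_unique_of_convex_combination (L := T * L) hDK hself hconj hTL ?_
      (lt_add_one _) ⟨h0, h1⟩ hσ hd
      (hq.congr_const (-c) fun p _ => ?_) (hq₀.congr_const (-c) fun p _ => ?_)
    · intro p hp r hr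
      have := lipschitz_timeIntegral hHc hL0 hL hzero ht₁'
        ((hDK p hp).trans (le_add_of_nonneg_right zero_le_one))
        ((hDK r hr).trans (le_add_of_nonneg_right zero_le_one))
      simpa only [timeIntegral_zero, sub_zero, add_sub_cancel_left] using this
    all_goals rw [hθc p]; ring

end Propagation

end HopfFormula

theorem corollary3p7 (n : ℕ) (T : ℝ) (hT : 0 < T)
    (H : ℝ → HopfFormula.Rn n → ℝ) (σ : HopfFormula.Rn n → ℝ)
    (hH : ContDiffOn ℝ 1 (fun z : ℝ × HopfFormula.Rn n => H z.1 z.2)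
      (Set.Icc 0 T ×ˢ (Set.univ : Set (HopfFormula.Rn n))))
    (hσ : ContDiff ℝ 1 σ) (hσconv : ConvexOn ℝ Set.univ σ)
    (hσLip : ∃ K : NNReal, LipschitzWith K σ)
    (hA1 : HopfFormula.AssumptionA1 T H σ) (hA2 : HopfFormula.AssumptionA2 T H)
    (t₀ : ℝ) (x₀ : HopfFormula.Rn n)
    (hsing : HopfFormula.IsSingularPoint T (HopfFormula.hopf H σ) (t₀, x₀)) :
    (∀ ε > (0 : ℝ), ∀ t ∈ Set.Ioo t₀ T, ∃ x : HopfFormula.Rn n,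
      HopfFormula.IsSingularPoint T (HopfFormula.hopf H σ) (t, x) ∧
        ∃ m : ℕ, ‖x - x₀‖ ≤ m * ε) ∧
    (∀ ε > (0 : ℝ), ∃ m : ℕ, ∀ t ∈ Set.Ioc t₀ T, ∃ x : HopfFormula.Rn n,
      ¬ DifferentiableWithinAt ℝ (HopfFormula.hopf H σ)
          (Set.Ioc 0 T ×ˢ (Set.univ : Set (HopfFormula.Rn n))) (t, x) ∧
        ‖x - x₀‖ ≤ m * ε) := by
  obtain ⟨⟨ht₀, -⟩, hnd⟩ := hsing
  obtain ⟨K, hK⟩ := hσLip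
  obtain ⟨M, hM⟩ := HopfFormula.exists_radius_forall_differentiableAt hT hH
    (hσ.differentiable one_ne_zero) hσconv hK hA2
  have key : ∀ t ∈ Set.Ioc t₀ T, ∃ x : HopfFormula.Rn n,
      ¬ DifferentiableWithinAt ℝ (HopfFormula.hopf H σ)
          (Set.Ioc 0 T ×ˢ (Set.univ : Set (HopfFormula.Rn n))) (t, x) ∧ ‖x - x₀‖ ≤ M := by
    intro t ht
    by_contra! hcon
    refine hnd (hM t₀ ht₀ x₀ t ht fun x hx => ?_)
    have hdw : DifferentiableWithinAt ℝ (HopfFormula.hopf H σ)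
        (Set.Ioc 0 T ×ˢ (Set.univ : Set (HopfFormula.Rn n))) (t, x) := by
      by_contra hn
      exact absurd hx (not_le.2 (hcon x hn))
    have hmk : DifferentiableWithinAt ℝ (fun y : HopfFormula.Rn n => (t, y)) Set.univ x :=
      ((differentiableAt_const t).prodMk differentiableAt_id).differentiableWithinAt
    -- The slice at fixed `t` stays inside `(0, T] × ℝⁿ`, so even at `t = T` one-sided joint
    -- differentiability yields full differentiability in `x`.
    exact differentiableWithinAt_univ.1
      (hdw.comp x hmk fun y _ => ⟨⟨ht₀.1.trans ht.1, ht.2⟩, Set.mem_univ y⟩)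
  -- Since `M` does not depend on `t`, one `m` serves all later times.
  have bound : ∀ ε > (0 : ℝ), ∃ m : ℕ, M ≤ m * ε := fun ε hε => by
    obtain ⟨m, hm⟩ := exists_nat_ge (M / ε)
    exact ⟨m, (div_le_iff₀ hε).1 hm⟩
  refine ⟨fun ε hε t ht => ?_, fun ε hε => ?_⟩
  · obtain ⟨m, hm⟩ := bound ε hε
    obtain ⟨x, hx, hxM⟩ := key t (Set.Ioo_subset_Ioc_self ht)
    exact ⟨x, ⟨⟨⟨ht₀.1.trans ht.1, ht.2⟩, Set.mem_univ x⟩,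
      fun hdiff => hx hdiff.differentiableWithinAt⟩, m, hxM.trans hm⟩
  · obtain ⟨m, hm⟩ := bound ε hε
    refine ⟨m, fun t ht => ?_⟩
    obtain ⟨x, hx, hxM⟩ := key t ht
    exact ⟨x, hx, hxM.trans hm⟩
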